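/- Let $\varrho$ be the substitution $0\mapsto 02,\ 1\mapsto 32,\ 2\mapsto 01,\ 3\mapsto 31$ on $\{0,1,2,3\}$. Let $(x_i)_{i\in\mathbb Z}$ be a bi-infinite fixed point of $\varrho^2$ with one of the legal seeds $x_{-1}|x_0\in\{2|0,\ 2|3,\ 1|0,\ 1|3\}$, and let $(w_i)_{i\in\mathbb Z}$ be the corresponding bi-infinite binary Rudin--Shapiro sequence with balanced weights, that is, $w_i=1$ if $x_i\in\{0,2\}$ and $w_i=-1$ if $x_i\in\{1,3\}$. For $(m_1,m_2,m_3)\in\mathbb Z^3$ let $$\theta^{(4)}(m_1,m_2,m_3)=\lim_{N\to\infty}\frac1{2N+1}\sum_{i=-N}^{N}(-1)^i\,w_i\,w_{i+m_1}\,w_{i+m_2}\,w_{i+m_3}.$$ Then, for all $\ell\in\mathbb Z$ and all integers $n\ge 1$ and $m\ge 0$, the following limits exist and have the stated values: $$\theta^{(4)}\bigl(2^{m}(1,\ 2^{n}(2\ell+1),\ 2^{n}(2\ell+1)+1)\bigr)=\Bigl(\frac{3}{2^{n}}-2\,\delta_{n,1}\Bigr)\delta_{0,m},$$ $$\theta^{(4)}\bigl(2^{m}(1,\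 2\ell+1,\ 2\ell+2)\bigr)=0,$$ where $\delta$ is the Kronecker delta. -/

import Mathlib

open Filter Topology

namespace RudinShapiro

/-- The quaternary Rudin–Shapiro substitution
`0 ↦ 02`, `1 ↦ 32`, `2 ↦ 01`, `3 ↦ 31`; `subst a k` is the `k`-th letter of the image of `a`. -/
def subst : Fin 4 → Fin 2 → Fin 4 :=
  ![![0, 2], ![3, 2], ![0, 1], ![3, 1]]

/-- The action of the substitution on bi-infinite words: the image of the letter at position `i`
occupies the positions `2 * i` and `2 * i + 1`. -/
def applySubst (x : ℤ → Fin 4) (n : ℤ) : Fin 4 :=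
  subst (x (n / 2)) (if n % 2 = 0 then 0 else 1)

/-- The legal seeds `l|r` (letters at positions `-1` and `0`): `2|0`, `2|3`, `1|0`, `1|3`. -/
def IsLegalSeed (l r : Fin 4) : Prop :=
  (l = 2 ∧ r = 0) ∨ (l = 2 ∧ r = 3) ∨ (l = 1 ∧ r = 0) ∨ (l = 1 ∧ r = 3)

/-- The bi-infinite quaternary Rudin–Shapiro word with seed `l|r`. For a legal seed it is the
unique bi-infinite fixed point of the square of the substitution with this seed, see
`applySubst_applySubst_quaternary` and `eq_quaternary`. -/
def quaternary (l r : Fin 4) (n : ℤ) : Fin 4 :=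
  if n = 0 then r
  else if n = -1 then l
  else subst (subst (quaternary l r (n / 4)) (if n / 2 % 2 = 0 then 0 else 1))
    (if n % 2 = 0 then 0 else 1)
termination_by n.natAbs
decreasing_by omega

theorem applySubst_applySubst_quaternary {l r : Fin 4} (h : IsLegalSeed l r) :
    applySubst (applySubst (quaternary l r)) = quaternary l r := by
  have h0 : quaternary l r 0 = r := by rw [quaternary]; simp
  have h1 : quaternary l r (-1) = l := by rw [quaternary]; simp
  funext n
  unfold applySubst
  rw [Int.ediv_ediv_of_nonneg (by norm_num)]
  norm_num
  by_cases hn : n = 0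
  · subst hn
    norm_num [h0]
    rcases h with ⟨rfl, rfl⟩ | ⟨rfl, rfl⟩ | ⟨rfl, rfl⟩ | ⟨rfl, rfl⟩ <;> decide
  by_cases hn' : n = -1
  · subst hn'
    norm_num [h1]
    rcases h with ⟨rfl, rfl⟩ | ⟨rfl, rfl⟩ | ⟨rfl, rfl⟩ | ⟨rfl, rfl⟩ <;> decide
  conv_rhs => rw [quaternary]
  simp [hn, hn']

theorem eq_quaternary {l r : Fin 4} {x : ℤ → Fin 4} (hx : applySubst (applySubst x) = x)
    (hl : x (-1) = l) (hr : x 0 = r) : x = quaternary l r := by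
  have key : ∀ k : ℕ, ∀ n : ℤ, n.natAbs = k → x n = quaternary l r n := by
    intro k
    induction k using Nat.strong_induction_on with
    | _ k ih =>
      intro n hk
      rw [quaternary]
      split_ifs with h0 h1 <;> first
        | (subst h0; exact hr)
        | (subst h1; exact hl)
        | skip
      all_goals
        rw [← ih (n / 4).natAbs (by omega) (n / 4) rfl]
        conv_lhs => rw [← hx]
        unfold applySubst
        rw [Int.ediv_ediv_of_nonneg (by norm_num)]
        simp [*]
  exact funext fun n => key _ n rfl

/-- The balanced binary coding: letters `0, 2` have weight `1`, letters `1, 3` have weight `-1`. -/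
def weight : Fin 4 → ℝ :=
  ![1, -1, 1, -1]

/-- The bi-infinite binary Rudin–Shapiro sequence with balanced weights `±1` and seed `l|r`. -/
def binary (l r : Fin 4) (n : ℤ) : ℝ :=
  weight (quaternary l r n)

/-- The symmetric average
`(2N+1)⁻¹ ∑_{i=-N}^{N} (-1)^i w_i w_{i+m_1} ⋯ w_{i+m_k}` with `k` shifts. -/
noncomputable def signedAverage {k : ℕ} (w : ℤ → ℝ) (m : Fin k → ℤ) (N : ℕ) : ℝ :=
  1 / (2 * (N : ℝ) + 1) *
    ∑ i ∈ Finset.Icc (-(N : ℤ)) (N : ℤ), (-1 : ℝ) ^ i * (w i * ∏ j, w (i + m j))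

/-- The signed `(k+1)`-point correlation function `θ^(k+1)` of `w` exists at `m` and has the
value `c` there: the signed averages converge to `c`. -/
def HasSignedCorrelation {k : ℕ} (w : ℤ → ℝ) (m : Fin k → ℤ) (c : ℝ) : Prop :=
  Tendsto (signedAverage w m) atTop (𝓝 c)

end RudinShapiro

namespace RudinShapiro

/-! With `u i = w i * w (i + 1)`, the correlation at shifts `(1, k, k + 1)` is the signed two-point
correlation of `u` at distance `k`. The sequence `u` is of paperfolding type (`isFolding_binary`):
it alternates on even positions and reproduces itself up to the sign `(-1) ^ i` on odd ones.
Splitting means by parity (`HasMean.of_even_odd`) gives everything.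

For odd `k` the correlations reduce to the mean of `u`, which is zero. If `b(k)` is the unsigned
correlation, then `b(2k) = (-1)^k (1 + b(k)) / 2`, while the signed one at `2k` is `(-1)^k (1 -
b(k)) / 2`. Starting from `b = 0` at odd `k`, this gives `1 - 3/2^n` and then the stated values; the
Kronecker delta at `n = 1` comes from `(-1)^k = -1`.

For `m ≥ 1` all shifts are even, and the terms at positions `2i` and `2i + 1` cancel for all but
finitely many `i`. -/

/-! ### Symmetric means of functions on the integers -/

/-- The sum of `f` over the symmetric interval `[-N, N]`. -/
noncomputable def symmSum (f : ℤ → ℝ) (N : ℕ) : ℝ :=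
  ∑ i ∈ Finset.Icc (-(N : ℤ)) (N : ℤ), f i

/-- The symmetric averages of `f` converge to `c`. -/
def HasMean (f : ℤ → ℝ) (c : ℝ) : Prop :=
  Tendsto (fun N : ℕ => 1 / (2 * (N : ℝ) + 1) * symmSum f N) atTop (𝓝 c)

theorem symmSum_zero (f : ℤ → ℝ) : symmSum f 0 = f 0 := by
  simp [symmSum]

theorem symmSum_succ (f : ℤ → ℝ) (N : ℕ) :
    symmSum f (N + 1) = symmSum f N + f (N + 1) + f (-(N + 1)) := by
  have h : Finset.Icc (-((N + 1 : ℕ) : ℤ)) ((N + 1 : ℕ) : ℤ) =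
      insert (-((N : ℤ) + 1)) (insert ((N : ℤ) + 1) (Finset.Icc (-(N : ℤ)) (N : ℤ))) := by
    ext i
    simp only [Finset.mem_Icc, Finset.mem_insert]
    push_cast
    omega
  unfold symmSum
  rw [h, Finset.sum_insert, Finset.sum_insert]
  · ring
  · simp
  · simp only [Finset.mem_insert, Finset.mem_Icc]
    omega

theorem symmSum_add (f g : ℤ → ℝ) (N : ℕ) :
    symmSum (fun i => f i + g i) N = symmSum f N + symmSum g N :=
  Finset.sum_add_distrib

theorem symmSum_two_mul (f : ℤ → ℝ) (M : ℕ) :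
    symmSum f (2 * M) = symmSum (fun i => f (2 * i) + f (2 * i + 1)) M - f (2 * M + 1) := by
  induction M with
  | zero => simp [symmSum_zero]
  | succ M ih =>
    rw [show 2 * (M + 1) = 2 * M + 1 + 1 by ring, symmSum_succ, symmSum_succ, symmSum_succ, ih]
    push_cast
    rw [show (2 * (-((M : ℤ) + 1)) + 1) = -(2 * M + 1) by ring,
      show (2 * (-((M : ℤ) + 1))) = -(2 * M + 1 + 1) by ring,
      show 2 * ((M : ℤ) + 1) = 2 * M + 1 + 1 by ring]
    ring

theorem abs_symmSum_le {f : ℤ → ℝ} {B : ℝ} (hf : ∀ i, |f i| ≤ B) (N : ℕ) :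
    |symmSum f N| ≤ (2 * N + 1) * B := by
  induction N with
  | zero => simpa [symmSum_zero] using hf 0
  | succ N ih =>
    rw [symmSum_succ]
    push_cast
    have h1 := abs_add_le (symmSum f N + f (N + 1)) (f (-(N + 1)))
    have h2 := abs_add_le (symmSum f N) (f (N + 1))
    linarith [hf (N + 1), hf (-(N + 1))]

/-- The blocks with index in `[-M, M]` cover `[-2M, 2M + 1]`, which differs from `[-N, N]` by one
point for either parity of `N`. -/
theorem abs_symmSum_sub_half_le {f : ℤ → ℝ} {B : ℝ} (hf : ∀ i, |f i| ≤ B) (N : ℕ) :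
    |symmSum f N - symmSum (fun i => f (2 * i) + f (2 * i + 1)) (N / 2)| ≤ B := by
  rcases Nat.even_or_odd' N with ⟨M, rfl | rfl⟩
  · rw [Nat.mul_div_cancel_left _ two_pos, symmSum_two_mul, sub_sub_cancel_left, abs_neg]
    exact hf _
  · rw [show (2 * M + 1) / 2 = M by omega, symmSum_succ, symmSum_two_mul]
    push_cast
    refine le_of_eq_of_le ?_ (hf (-(2 * M + 1)))
    congr 1
    ring

theorem tendsto_inv_mul_of_bounded {g : ℕ → ℝ} {C : ℝ} (hg : ∀ N, |g N| ≤ C) :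
    Tendsto (fun N : ℕ => 1 / (2 * (N : ℝ) + 1) * g N) atTop (𝓝 0) := by
  refine Tendsto.zero_mul_isBoundedUnder_le ?_ ⟨C, by simpa using ⟨0, fun N _ => hg N⟩⟩
  simp only [one_div]
  refine tendsto_inv_atTop_zero.comp (tendsto_atTop_add_const_right _ _ ?_)
  exact tendsto_natCast_atTop_atTop.const_mul_atTop two_pos

theorem HasMean.add {f g : ℤ → ℝ} {a b : ℝ} (hf : HasMean f a) (hg : HasMean g b) :
    HasMean (fun i => f i + g i) (a + b) := by
  refine (Tendsto.add hf hg).congr fun N => ?_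
  rw [symmSum_add]
  ring

theorem HasMean.const_mul {f : ℤ → ℝ} {a : ℝ} (c : ℝ) (hf : HasMean f a) :
    HasMean (fun i => c * f i) (c * a) := by
  refine (Tendsto.const_mul c hf).congr fun N => ?_
  rw [symmSum, symmSum, ← Finset.mul_sum]
  ring

theorem hasMean_const (c : ℝ) : HasMean (fun _ => c) c := by
  refine tendsto_const_nhds.congr fun N => ?_
  have h : ((Int.toNat ((N : ℤ) + 1 - -(N : ℤ)) : ℕ) : ℝ) = 2 * N + 1 := by
    rw [show (N : ℤ) + 1 - -(N : ℤ) = ((2 * N + 1 : ℕ) : ℤ) by push_cast; ring, Int.toNat_natCast]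
    push_cast
    ring
  rw [symmSum, Finset.sum_const, Int.card_Icc, nsmul_eq_mul, h]
  field_simp

theorem HasMean.of_symmSum_sub_bounded {f g : ℤ → ℝ} {a C : ℝ} (hf : HasMean f a)
    (h : ∀ N, |symmSum g N - symmSum f N| ≤ C) : HasMean g a := by
  have := Tendsto.add hf (tendsto_inv_mul_of_bounded h)
  rw [add_zero] at this
  refine this.congr fun N => ?_
  ring

theorem HasMean.congr_cofinite {f g : ℤ → ℝ} {a : ℝ} (hf : HasMean f a)
    (h : ∀ᶠ i in cofinite, f i = g i) : HasMean g a := by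
  have hs : {i | ¬ f i = g i}.Finite := h
  refine hf.of_symmSum_sub_bounded (C := ∑ i ∈ hs.toFinset, |g i - f i|) fun N => ?_
  rw [symmSum, symmSum, ← Finset.sum_sub_distrib]
  refine (Finset.abs_sum_le_sum_abs _ _).trans ?_
  rw [← Finset.sum_filter_ne_zero]
  refine Finset.sum_le_sum_of_subset_of_nonneg (fun i hi => ?_) fun _ _ _ => abs_nonneg _
  simp only [Set.Finite.mem_toFinset, Set.mem_ofPred_eq]
  intro h
  simp [h] at hi

theorem HasMean.shift_one {f : ℤ → ℝ} {a B : ℝ} (hB : ∀ i, |f i| ≤ B) (hf : HasMean f a) :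
    HasMean (fun i => f (i + 1)) a := by
  refine hf.of_symmSum_sub_bounded (C := B + B) fun N => ?_
  have h : symmSum (fun i => f (i + 1)) N - symmSum f N = f (N + 1) - f (-N) := by
    induction N with
    | zero => simp [symmSum_zero]
    | succ N ih =>
      rw [symmSum_succ, symmSum_succ]
      push_cast
      rw [show -((N : ℤ) + 1) + 1 = -N by ring]
      linarith
  rw [h]
  exact (abs_sub _ _).trans (add_le_add (hB _) (hB _))

theorem HasMean.of_shift_one {f : ℤ → ℝ} {a B : ℝ} (hB : ∀ i, |f i| ≤ B)
    (hf : HasMean (fun i => f (i + 1)) a) : HasMean f a := by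
  refine hf.of_symmSum_sub_bounded (C := B + B) fun N => ?_
  have h : symmSum f N - symmSum (fun i => f (i + 1)) N = f (-N) - f (N + 1) := by
    induction N with
    | zero => simp [symmSum_zero]
    | succ N ih =>
      rw [symmSum_succ, symmSum_succ]
      push_cast
      rw [show -((N : ℤ) + 1) + 1 = -N by ring]
      linarith
  rw [h]
  exact (abs_sub _ _).trans (add_le_add (hB _) (hB _))

theorem HasMean.shift {f : ℤ → ℝ} {a B : ℝ} (hB : ∀ i, |f i| ≤ B) (hf : HasMean f a) (k : ℤ) :
    HasMean (fun i => f (i + k)) a := by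
  induction k using Int.induction_on with
  | zero => simpa using hf
  | succ k ih =>
    have := ih.shift_one (fun i => hB _)
    simpa only [add_right_comm _ (1 : ℤ), add_assoc] using this
  | pred k ih =>
    refine HasMean.of_shift_one (fun i => hB _) ?_
    convert ih using 3
    ring

/-- If the block sums `f (2i) + f (2i+1)` of a bounded function have mean `c`, then `f` has
mean `c / 2`. -/
theorem HasMean.of_blocks {f : ℤ → ℝ} {c B : ℝ} (hB : ∀ i, |f i| ≤ B)
    (h : HasMean (fun i => f (2 * i) + f (2 * i + 1)) c) : HasMean f (c / 2) := by
  set g : ℤ → ℝ := fun i => f (2 * i) + f (2 * i + 1) with hg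
  have hgB : ∀ i, |g i| ≤ B + B := fun i => (abs_add_le _ _).trans (add_le_add (hB _) (hB _))
  have h1 : Tendsto (fun N : ℕ => 1 / 2 * (1 / (2 * ((N / 2 : ℕ) : ℝ) + 1) * symmSum g (N / 2)))
      atTop (𝓝 (1 / 2 * c)) :=
    (h.comp (Nat.tendsto_div_const_atTop two_ne_zero)).const_mul _
  have h2 := h1.add (tendsto_inv_mul_of_bounded
    (g := fun N => symmSum f N - (2 * (N : ℝ) + 1) / 2 *
      (1 / (2 * ((N / 2 : ℕ) : ℝ) + 1) * symmSum g (N / 2))) (C := B + (B + B)) ?_)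
  · rw [add_zero, one_div_mul_eq_div] at h2
    refine h2.congr fun N => ?_
    have : (2 * (N : ℝ) + 1) ≠ 0 := by positivity
    field_simp
    ring
  · intro N
    set M := N / 2 with hM
    have hd : (0 : ℝ) < 2 * M + 1 := by positivity
    have hMN : |1 - (2 * (N : ℝ) + 1) / 2 * (1 / (2 * (M : ℝ) + 1))| ≤ 1 / (2 * M + 1) := by
      have e : 1 - (2 * (N : ℝ) + 1) / 2 * (1 / (2 * (M : ℝ) + 1)) =
          (4 * M + 1 - 2 * N) / 2 / (2 * M + 1) := by
        field_simp
        ring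
      rw [e, abs_div, abs_of_pos hd]
      gcongr
      have l1 : (2 * M : ℝ) ≤ N := by exact_mod_cast (by omega : 2 * M ≤ N)
      have l2 : (N : ℝ) ≤ 2 * M + 1 := by exact_mod_cast (by omega : N ≤ 2 * M + 1)
      rw [abs_le]
      constructor <;> linarith
    have e : symmSum f N - (2 * (N : ℝ) + 1) / 2 * (1 / (2 * (M : ℝ) + 1) * symmSum g M) =
        (symmSum f N - symmSum g M) +
          (1 - (2 * (N : ℝ) + 1) / 2 * (1 / (2 * (M : ℝ) + 1))) * symmSum g M := by
      ring
    rw [e]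
    refine (abs_add_le _ _).trans (add_le_add (abs_symmSum_sub_half_le hB N) ?_)
    rw [abs_mul]
    calc _ ≤ 1 / (2 * (M : ℝ) + 1) * ((2 * M + 1) * (B + B)) :=
          mul_le_mul hMN (abs_symmSum_le hgB M) (abs_nonneg _) (by positivity)
      _ = B + B := by field_simp

theorem HasMean.of_even_odd {f : ℤ → ℝ} {a b B : ℝ} (hB : ∀ i, |f i| ≤ B)
    (he : HasMean (fun i => f (2 * i)) a) (ho : HasMean (fun i => f (2 * i + 1)) b) :
    HasMean f ((a + b) / 2) :=
  HasMean.of_blocks hB (he.add ho)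

/-- Iterating the inequality contracts the bound by `3/5` each time; the errors stay below `ε/2`
because `1/5 + (3/5)(1/2) = 1/2`. -/
theorem tendsto_zero_of_halving {a e : ℕ → ℝ} {B : ℝ} (ha : ∀ N, |a N| ≤ B)
    (he : Tendsto e atTop (𝓝 0)) (h : ∀ᶠ N in atTop, |a N| ≤ e N + 3 / 5 * |a (N / 2)|) :
    Tendsto a atTop (𝓝 0) := by
  have hB : 0 ≤ B := (abs_nonneg _).trans (ha 0)
  have key : ∀ ε > 0, ∀ k : ℕ, ∀ᶠ N in atTop, |a N| ≤ (3 / 5) ^ k * B + ε / 2 := by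
    intro ε hε k
    induction k with
    | zero => exact Eventually.of_forall fun N => by linarith [ha N]
    | succ k ih =>
      filter_upwards [h, (Nat.tendsto_div_const_atTop two_ne_zero).eventually ih,
        he.eventually (gt_mem_nhds (show 0 < ε / 5 by linarith))] with N h1 h2 h3
      rw [pow_succ]
      linarith
  rw [Metric.tendsto_nhds]
  intro ε hε
  have hk : ∃ k : ℕ, (3 / 5 : ℝ) ^ k * B < ε / 2 := by
    have : Tendsto (fun k : ℕ => (3 / 5 : ℝ) ^ k * B) atTop (𝓝 (0 * B)) :=
      (tendsto_pow_atTop_nhds_zero_of_lt_one (by norm_num) (by norm_num)).mul_const B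
    rw [zero_mul] at this
    exact (this.eventually (gt_mem_nhds (half_pos hε))).exists
  obtain ⟨k, hk⟩ := hk
  filter_upwards [key ε hε k] with N hN
  rw [Real.dist_eq, sub_zero]
  linarith

/-- A bounded function whose even part has mean zero and whose odd part reproduces the negative
of the function has mean zero. -/
theorem hasMean_zero_of_odd_eq_neg {f : ℤ → ℝ} {B : ℝ} (hB : ∀ i, |f i| ≤ B)
    (he : HasMean (fun i => f (2 * i)) 0) (ho : ∀ᶠ i in cofinite, f (2 * i + 1) = -f i) :
    HasMean f 0 := by
  -- Formally the mean `s` satisfies `s = (0 - s) / 2`. Existence of `s` is not known, so this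
  -- relation is turned into a contraction between the averages at `N` and at `N / 2`.
  have hr : HasMean (fun i => f (2 * i) + f (2 * i + 1) + f i) 0 :=
    he.congr_cofinite (ho.mono fun i hi => by rw [hi]; ring)
  set g : ℤ → ℝ := fun i => f (2 * i) + f (2 * i + 1) + f i with hg
  have hbd : ∀ N : ℕ, |1 / (2 * (N : ℝ) + 1) * symmSum f N| ≤ B := by
    intro N
    have hd : (0 : ℝ) < 2 * N + 1 := by positivity
    rw [abs_mul, abs_of_pos (by positivity), one_div_mul_eq_div, div_le_iff₀ hd, mul_comm B]
    exact abs_symmSum_le hB N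
  have he' : Tendsto (fun N : ℕ => 1 / (2 * (N : ℝ) + 1) * B +
      |1 / (2 * ((N / 2 : ℕ) : ℝ) + 1) * symmSum g (N / 2)|) atTop (𝓝 0) := by
    have h1 := tendsto_inv_mul_of_bounded (g := fun _ => B) (fun _ => le_rfl)
    have h2 := (hr.comp (Nat.tendsto_div_const_atTop two_ne_zero)).abs
    simpa using h1.add h2
  refine tendsto_zero_of_halving hbd he' ?_
  filter_upwards [eventually_ge_atTop 2] with N hN
  set M := N / 2 with hM
  have hd : (0 : ℝ) < 2 * M + 1 := by positivity
  have hd' : (0 : ℝ) < 2 * N + 1 := by positivity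
  have l1 : (2 * M : ℝ) ≤ N := by exact_mod_cast (by omega : 2 * M ≤ N)
  have l2 : (1 : ℝ) ≤ M := by exact_mod_cast (by omega : 1 ≤ M)
  -- Since `N ≥ 2M`, the ratio is at most `(2M + 1) / (4M + 1)`, which is `3/5` at `M = 1` and
  -- decreases.
  have hle : 1 / (2 * (N : ℝ) + 1) ≤ 1 / (2 * M + 1) * (3 / 5) := by
    rw [div_mul_eq_mul_div, one_mul, div_le_div_iff₀ hd' hd]
    linarith
  have hle' : 1 / (2 * (N : ℝ) + 1) ≤ 1 / (2 * M + 1) := by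
    rw [div_le_div_iff₀ hd' hd]
    linarith
  have hs : symmSum g M = symmSum (fun i => f (2 * i) + f (2 * i + 1)) M + symmSum f M :=
    symmSum_add _ _ _
  have hh := abs_symmSum_sub_half_le hB N
  rw [← hM, eq_sub_of_add_eq hs.symm] at hh
  have ht : |symmSum f N| ≤ B + |symmSum g M| + |symmSum f M| := by
    have e : symmSum f N = (symmSum f N - (symmSum g M - symmSum f M)) + symmSum g M +
      -symmSum f M := by ring
    have h1 := abs_add_le ((symmSum f N - (symmSum g M - symmSum f M)) + symmSum g M)
      (-symmSum f M)
    have h2 := abs_add_le (symmSum f N - (symmSum g M - symmSum f M)) (symmSum g M)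
    rw [← e, abs_neg] at h1
    linarith
  rw [abs_mul, abs_mul, abs_mul, abs_of_pos (show 0 < 1 / (2 * (N : ℝ) + 1) by positivity),
    abs_of_pos (show 0 < 1 / (2 * (M : ℝ) + 1) by positivity)]
  calc _ ≤ 1 / (2 * (N : ℝ) + 1) * (B + |symmSum g M| + |symmSum f M|) := by gcongr
    _ = 1 / (2 * (N : ℝ) + 1) * B + 1 / (2 * (N : ℝ) + 1) * |symmSum g M| +
        1 / (2 * (N : ℝ) + 1) * |symmSum f M| := by ring
    _ ≤ 1 / (2 * (N : ℝ) + 1) * B + 1 / (2 * (M : ℝ) + 1) * |symmSum g M| +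
        1 / (2 * (M : ℝ) + 1) * (3 / 5) * |symmSum f M| := by gcongr
    _ = _ := by ring

/-! ### Signs -/

theorem neg_one_zpow_two_mul (i : ℤ) : (-1 : ℝ) ^ (2 * i) = 1 :=
  (even_two_mul i).neg_one_zpow

theorem neg_one_zpow_two_mul_add_one (i : ℤ) : (-1 : ℝ) ^ (2 * i + 1) = -1 :=
  (odd_two_mul_add_one i).neg_one_zpow

theorem neg_one_zpow_add (i j : ℤ) : (-1 : ℝ) ^ (i + j) = (-1) ^ i * (-1) ^ j :=
  zpow_add₀ (by norm_num) i j

theorem neg_one_zpow_mul_self (i : ℤ) : (-1 : ℝ) ^ i * (-1) ^ i = 1 := by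
  rw [← neg_one_zpow_add, ← two_mul, neg_one_zpow_two_mul]

theorem abs_neg_one_zpow (i : ℤ) : |(-1 : ℝ) ^ i| = 1 := by
  rw [abs_zpow]
  simp

theorem hasMean_neg_one_zpow : HasMean (fun i => (-1 : ℝ) ^ i) 0 := by
  have h := HasMean.of_even_odd (f := fun i => (-1 : ℝ) ^ i) (a := 1) (b := -1)
    (fun i => (abs_neg_one_zpow i).le)
    (by simpa only [neg_one_zpow_two_mul] using hasMean_const 1)
    (by simpa only [neg_one_zpow_two_mul_add_one] using hasMean_const (-1))
  simpa using h

theorem eventually_cofinite_add {p : ℤ → Prop} (h : ∀ᶠ i in cofinite, p i) (k : ℤ) :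
    ∀ᶠ i in cofinite, p (i + k) :=
  (add_left_injective k).tendsto_cofinite.eventually h

/-! ### Correlations of paperfolding-like sequences -/

/-- A `±1`-bounded sequence with `u (2i) = (-1)^i` and `u (2i+1) = (-1)^i u i`, the latter up to
finitely many exceptions. -/
structure IsFolding (u : ℤ → ℝ) : Prop where
  abs_le : ∀ i, |u i| ≤ 1
  even : ∀ i, u (2 * i) = (-1) ^ i
  odd : ∀ᶠ i in cofinite, u (2 * i + 1) = (-1) ^ i * u i

namespace IsFolding

variable {u : ℤ → ℝ}

theorem abs_mul_le (hu : IsFolding u) (i j : ℤ) : |u i * u j| ≤ 1 := by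
  rw [abs_mul]
  exact mul_le_one₀ (hu.abs_le i) (abs_nonneg _) (hu.abs_le j)

theorem abs_signed_le {f : ℤ → ℝ} (hf : ∀ i, |f i| ≤ 1) (i : ℤ) : |(-1 : ℝ) ^ i * f i| ≤ 1 := by
  rw [abs_mul, abs_neg_one_zpow, one_mul]
  exact hf i

theorem hasMean_signed (hu : IsFolding u) : HasMean (fun i => (-1 : ℝ) ^ i * u i) 0 := by
  refine hasMean_zero_of_odd_eq_neg (abs_signed_le hu.abs_le) ?_ ?_
  · simpa only [neg_one_zpow_two_mul, hu.even, one_mul] using hasMean_neg_one_zpow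
  · filter_upwards [hu.odd] with i hi
    rw [neg_one_zpow_two_mul_add_one, hi]
    ring

theorem hasMean (hu : IsFolding u) : HasMean u 0 := by
  have h := HasMean.of_even_odd (f := u) hu.abs_le (a := 0) (b := 0)
    (by simpa only [hu.even] using hasMean_neg_one_zpow)
    (hu.hasMean_signed.congr_cofinite (hu.odd.mono fun i hi => hi.symm))
  simpa using h

/-- The even-indexed factor is a pure sign that cancels the `(-1) ^ i` of the other factor, leaving
a constant times a shift of `u`. -/
theorem hasMean_even_mul_odd (hu : IsFolding u) (k : ℤ) :
    HasMean (fun i => u (2 * i) * u (2 * i + (2 * k + 1))) 0 := by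
  have h := (hu.hasMean.shift hu.abs_le k).const_mul ((-1) ^ k)
  rw [mul_zero] at h
  refine h.congr_cofinite ?_
  filter_upwards [eventually_cofinite_add hu.odd k] with i hi
  rw [show 2 * i + (2 * k + 1) = 2 * (i + k) + 1 by ring, hi, hu.even, neg_one_zpow_add]
  linear_combination (-(-1) ^ k * u (i + k)) * neg_one_zpow_mul_self i

theorem hasMean_odd_mul_even (hu : IsFolding u) (k : ℤ) :
    HasMean (fun i => u (2 * i + 1) * u (2 * i + 1 + (2 * k + 1))) 0 := by
  have h := hu.hasMean.const_mul ((-1) ^ (k + 1))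
  rw [mul_zero] at h
  refine h.congr_cofinite ?_
  filter_upwards [hu.odd] with i hi
  rw [show 2 * i + 1 + (2 * k + 1) = 2 * (i + (k + 1)) by ring, hi, hu.even,
    neg_one_zpow_add i]
  linear_combination (-(-1) ^ (k + 1) * u i) * neg_one_zpow_mul_self i

theorem hasMean_mul_shift_odd (hu : IsFolding u) (k : ℤ) :
    HasMean (fun i => u i * u (i + (2 * k + 1))) 0 := by
  have h := HasMean.of_even_odd (f := fun i => u i * u (i + (2 * k + 1)))
    (fun i => hu.abs_mul_le _ _) (hu.hasMean_even_mul_odd k) (hu.hasMean_odd_mul_even k)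
  simpa using h

theorem hasMean_signed_mul_shift_odd (hu : IsFolding u) (k : ℤ) :
    HasMean (fun i => (-1 : ℝ) ^ i * (u i * u (i + (2 * k + 1)))) 0 := by
  have h := HasMean.of_even_odd (f := fun i => (-1 : ℝ) ^ i * (u i * u (i + (2 * k + 1))))
    (a := 0) (b := 0) (abs_signed_le fun i => hu.abs_mul_le _ _)
    (by simpa only [neg_one_zpow_two_mul, one_mul] using hu.hasMean_even_mul_odd k)
    (by simpa only [neg_one_zpow_two_mul_add_one, mul_zero] using
      (hu.hasMean_odd_mul_even k).const_mul (-1))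
  simpa using h

theorem even_mul_even (hu : IsFolding u) (k i : ℤ) :
    u (2 * i) * u (2 * i + 2 * k) = (-1) ^ k := by
  rw [← mul_add, hu.even, hu.even, neg_one_zpow_add]
  linear_combination (-1) ^ k * neg_one_zpow_mul_self i

theorem hasMean_odd_mul_odd (hu : IsFolding u) {k : ℤ} {b : ℝ}
    (hb : HasMean (fun i => u i * u (i + k)) b) :
    HasMean (fun i => u (2 * i + 1) * u (2 * i + 1 + 2 * k)) ((-1) ^ k * b) := by
  refine (hb.const_mul ((-1) ^ k)).congr_cofinite ?_
  filter_upwards [hu.odd, eventually_cofinite_add hu.odd k] with i h1 h2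
  rw [show 2 * i + 1 + 2 * k = 2 * (i + k) + 1 by ring, h1, h2, neg_one_zpow_add]
  linear_combination (-(-1) ^ k * u i * u (i + k)) * neg_one_zpow_mul_self i

theorem hasMean_mul_shift_even (hu : IsFolding u) {k : ℤ} {b : ℝ}
    (hb : HasMean (fun i => u i * u (i + k)) b) :
    HasMean (fun i => u i * u (i + 2 * k)) (((-1) ^ k + (-1) ^ k * b) / 2) :=
  HasMean.of_even_odd (f := fun i => u i * u (i + 2 * k)) (fun i => hu.abs_mul_le _ _)
    (by simpa only [hu.even_mul_even] using hasMean_const ((-1) ^ k)) (hu.hasMean_odd_mul_odd hb)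

theorem hasMean_signed_mul_shift_even (hu : IsFolding u) {k : ℤ} {b : ℝ}
    (hb : HasMean (fun i => u i * u (i + k)) b) :
    HasMean (fun i => (-1 : ℝ) ^ i * (u i * u (i + 2 * k)))
      (((-1) ^ k + -1 * ((-1) ^ k * b)) / 2) :=
  HasMean.of_even_odd (f := fun i => (-1 : ℝ) ^ i * (u i * u (i + 2 * k)))
    (abs_signed_le fun i => hu.abs_mul_le _ _)
    (by simpa only [neg_one_zpow_two_mul, one_mul, hu.even_mul_even] using
      hasMean_const ((-1) ^ k))
    (by simpa only [neg_one_zpow_two_mul_add_one] using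
      (hu.hasMean_odd_mul_odd hb).const_mul (-1))

/-- The first halving has odd `k` and sign `-1`, giving `-1/2`; every later one maps `b` to `(1 + b)
/ 2`, halving the distance to `1`. -/
theorem hasMean_mul_shift (hu : IsFolding u) (ℓ : ℤ) (n : ℕ) :
    HasMean (fun i => u i * u (i + 2 ^ (n + 1) * (2 * ℓ + 1))) (1 - 3 / 2 ^ (n + 1)) := by
  induction n with
  | zero =>
    have h := hu.hasMean_mul_shift_even (hu.hasMean_mul_shift_odd ℓ)
    rw [neg_one_zpow_two_mul_add_one] at h
    convert h using 1
    · simp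
    · norm_num
  | succ n ih =>
    have h := hu.hasMean_mul_shift_even ih
    rw [show (2 : ℤ) ^ (n + 1) * (2 * ℓ + 1) = 2 * (2 ^ n * (2 * ℓ + 1)) by ring,
      neg_one_zpow_two_mul] at h
    convert h using 1
    · ext i
      rw [show (2 : ℤ) ^ (n + 1 + 1) * (2 * ℓ + 1) = 2 * (2 * (2 ^ n * (2 * ℓ + 1))) by ring]
    · field_simp
      ring

theorem hasMean_signed_mul_shift (hu : IsFolding u) (ℓ : ℤ) {n : ℕ} (hn : 1 ≤ n) :
    HasMean (fun i => (-1 : ℝ) ^ i * (u i * u (i + 2 ^ n * (2 * ℓ + 1))))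
      (3 / 2 ^ n - 2 * (if n = 1 then 1 else 0)) := by
  obtain _ | _ | n := n
  · omega
  · have h := hu.hasMean_signed_mul_shift_even (hu.hasMean_mul_shift_odd ℓ)
    rw [neg_one_zpow_two_mul_add_one] at h
    convert h using 1
    · simp
    · norm_num
  · have h := hu.hasMean_signed_mul_shift_even (hu.hasMean_mul_shift ℓ n)
    rw [show (2 : ℤ) ^ (n + 1) * (2 * ℓ + 1) = 2 * (2 ^ n * (2 * ℓ + 1)) by ring,
      neg_one_zpow_two_mul] at h
    convert h using 1
    · ext i
      rw [show (2 : ℤ) ^ (n + 1 + 1) * (2 * ℓ + 1) = 2 * (2 * (2 ^ n * (2 * ℓ + 1))) by ring]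
    · simp
      field_simp
      ring

end IsFolding

/-! ### The binary Rudin–Shapiro sequence -/

theorem weight_subst_zero (a : Fin 4) : weight (subst a 0) = weight a := by
  fin_cases a <;> simp [weight, subst]

theorem weight_applySubst_even (x : ℤ → Fin 4) (n : ℤ) :
    weight (applySubst x (2 * n)) = weight (x n) := by
  simp [applySubst, weight_subst_zero]

/-- The second letter of an image keeps the weight of `0, 3` and flips that of `1, 2`. In an image
word, `0, 3` occupy the even positions and `1, 2` the odd ones, so the flip is `(-1) ^ n`. -/
theorem weight_applySubst_odd {x y : ℤ → Fin 4} (hx : x = applySubst y) (n : ℤ) :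
    weight (applySubst x (2 * n + 1)) = (-1) ^ n * weight (x n) := by
  have h1 : (2 * n + 1) / 2 = n := by omega
  have h2 : (2 * n + 1) % 2 = 1 := by omega
  have key : weight (subst (x n) 1) = (-1) ^ n * weight (x n) := by
    have he : ∀ a : Fin 4, weight (subst (subst a 0) 1) = weight (subst a 0) := by
      intro a; fin_cases a <;> simp [weight, subst]
    have ho : ∀ a : Fin 4, weight (subst (subst a 1) 1) = -weight (subst a 1) := by
      intro a; fin_cases a <;> simp [weight, subst]
    rw [hx]
    unfold applySubst
    rcases Int.even_or_odd' n with ⟨k, rfl | rfl⟩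
    · rw [neg_one_zpow_two_mul, if_pos (by omega), he, one_mul]
    · rw [neg_one_zpow_two_mul_add_one, if_neg (by omega), ho, neg_one_mul]
  rw [applySubst, h1, h2]
  simpa using key

/-- The sign `1` on nonnegative integers and `-1` on negative integers. -/
noncomputable def side (n : ℤ) : ℝ :=
  if 0 ≤ n then 1 else -1

theorem side_mul_self (n : ℤ) : side n * side n = 1 := by
  unfold side
  split_ifs <;> norm_num

theorem eventually_side_add (k : ℤ) : ∀ᶠ i in cofinite, side (i + k) = side i := by
  refine (Set.finite_Icc (-|k|) |k|).subset fun i hi => ?_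
  by_contra h
  apply hi
  rw [Set.mem_Icc, not_and_or] at h
  have h1 := le_abs_self k
  have h2 := neg_abs_le k
  unfold side
  congr 1
  exact propext ⟨fun _ => by omega, fun _ => by omega⟩

theorem binary_two_mul_and {l r : Fin 4} (h : IsLegalSeed l r) (n : ℤ) :
    binary l r (2 * n) = side n * binary l r n ∧
      binary l r (2 * n + 1) = side n * ((-1) ^ n * binary l r n) := by
  set x := quaternary l r with hx
  set y := applySubst x with hy
  have hxy : applySubst y = x := applySubst_applySubst_quaternary h
  have hw : ∀ n, binary l r n = weight (x n) := fun _ => rfl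
  have hx0 : ∀ n, weight (x (2 * n)) = weight (y n) := fun n => by
    rw [← hxy, weight_applySubst_even]
  have hx1 : ∀ n, weight (x (2 * n + 1)) = (-1) ^ n * weight (y n) := fun n => by
    rw [← hxy, weight_applySubst_odd hy]
  have hy0 : ∀ n, weight (y (2 * n)) = weight (x n) := fun n => weight_applySubst_even x n
  have hy1 : ∀ n, weight (y (2 * n + 1)) = (-1) ^ n * weight (x n) := fun n =>
    weight_applySubst_odd hxy.symm n
  -- The word is fixed only by the square of the substitution; one application negates the weights
  -- on the negative half-line, as the positions `0` and `-1` show.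
  have key : ∀ k : ℕ, ∀ n : ℤ, n.natAbs = k → weight (y n) = side n * weight (x n) := by
    intro k
    induction k using Nat.strong_induction_on with
    | _ k ih =>
      intro n hk
      by_cases h0 : n = 0
      · subst h0
        have := hx0 0
        simp only [mul_zero] at this
        simp [side, this]
      by_cases h1 : n = -1
      · subst h1
        have := hx1 (-1)
        norm_num at this
        simp [side, this]
      have hs : side n = side (n / 2) := by
        unfold side
        congr 1
        exact propext ⟨fun _ => by omega, fun _ => by omega⟩
      have hi := ih (n / 2).natAbs (by omega) (n / 2) rfl
      have hss := side_mul_self (n / 2)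
      rw [hs]
      rcases Int.even_or_odd' n with ⟨m, hm | hm⟩
      · have e : n / 2 = m := by omega
        rw [e] at hi hss ⊢
        rw [hm, hy0, hx0, hi]
        linear_combination (-weight (x m)) * hss
      · have e : n / 2 = m := by omega
        rw [e] at hi hss ⊢
        rw [hm, hy1, hx1, hi]
        linear_combination (-(-1) ^ m * weight (x m)) * hss
  rw [hw, hw, hw, hx0, hx1, key _ n rfl]
  exact ⟨rfl, by ring⟩

theorem binary_mul_self (l r : Fin 4) (n : ℤ) : binary l r n * binary l r n = 1 := by
  unfold binary
  generalize quaternary l r n = a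
  fin_cases a <;> simp [weight]

theorem abs_binary (l r : Fin 4) (n : ℤ) : |binary l r n| = 1 := by
  have := abs_mul_abs_self (binary l r n)
  rw [binary_mul_self] at this
  nlinarith [abs_nonneg (binary l r n)]

theorem isFolding_binary {l r : Fin 4} (h : IsLegalSeed l r) :
    IsFolding fun i => binary l r i * binary l r (i + 1) where
  abs_le i := by rw [abs_mul, abs_binary, abs_binary, one_mul]
  even i := by
    rw [(binary_two_mul_and h i).1, (binary_two_mul_and h i).2]
    linear_combination ((-1) ^ i * (binary l r i * binary l r i)) * side_mul_self i +
      (-1) ^ i * binary_mul_self l r i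
  odd := by
    -- The only exception is `i = -1`, where the pair straddles the origin.
    filter_upwards [eventually_side_add 1] with i hi
    rw [show 2 * i + 1 + 1 = 2 * (i + 1) by ring, (binary_two_mul_and h i).2,
      (binary_two_mul_and h (i + 1)).1, hi]
    linear_combination ((-1) ^ i * (binary l r i * binary l r (i + 1))) * side_mul_self i

theorem hasSignedCorrelation_three_iff (w : ℤ → ℝ) (p q s : ℤ) (c : ℝ) :
    HasSignedCorrelation w ![p, q, s] c ↔
      HasMean (fun i => (-1 : ℝ) ^ i * (w i * (w (i + p) * w (i + q) * w (i + s)))) c := by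
  refine tendsto_congr fun N => ?_
  simp only [symmSum, signedAverage, Fin.prod_univ_three]
  rfl

/-- Signed correlations at doubled shifts `2p, 2q, 2(p+q)` vanish. -/
theorem hasSignedCorrelation_two_mul {l r : Fin 4} (h : IsLegalSeed l r) (p q : ℤ) :
    HasSignedCorrelation (binary l r) ![2 * p, 2 * q, 2 * (p + q)] 0 := by
  rw [hasSignedCorrelation_three_iff, ← zero_div (2 : ℝ)]
  refine HasMean.of_blocks (B := 1) (fun i => ?_) ?_
  · simp [abs_mul, abs_binary]
  -- Away from the origin the four extra signs at `2i + 1` multiply to `(-1)^(4i + 2p + 2q) = 1`, so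
  -- the two terms of a block differ only by the alternating prefactor.
  refine (hasMean_const 0).congr_cofinite ?_
  filter_upwards [eventually_side_add p, eventually_side_add q, eventually_side_add (p + q)]
    with i h1 h2 h3
  have e (k : ℤ) : 2 * i + 1 + 2 * k = 2 * (i + k) + 1 := by ring
  rw [neg_one_zpow_two_mul, neg_one_zpow_two_mul_add_one, e, e, e, ← mul_add, ← mul_add, ← mul_add]
  simp only [(binary_two_mul_and h _).1, (binary_two_mul_and h _).2, h1, h2, h3,
    neg_one_zpow_add]
  have hi := neg_one_zpow_mul_self i
  have hp := neg_one_zpow_mul_self p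
  have hq := neg_one_zpow_mul_self q
  generalize (-1 : ℝ) ^ i = a at *
  generalize (-1 : ℝ) ^ p = b at *
  generalize (-1 : ℝ) ^ q = d at *
  have hprod : (a * a) * (a * a) * (b * b) * (d * d) = 1 := by rw [hi, hp, hq]; norm_num
  linear_combination (side i ^ 4 * binary l r i * binary l r (i + p) * binary l r (i + q) *
    binary l r (i + (p + q))) * hprod

theorem hasSignedCorrelation_one_iff (w : ℤ → ℝ) (c : ℝ) (k : ℤ) :
    HasSignedCorrelation w ![1, k, k + 1] c ↔
      HasMean (fun i => (-1 : ℝ) ^ i * ((w i * w (i + 1)) * (w (i + k) * w (i + k + 1)))) c := by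
  rw [hasSignedCorrelation_three_iff]
  simp only [mul_assoc, add_assoc]

theorem hasSignedCorrelation_pow_smul {l r : Fin 4} (h : IsLegalSeed l r) (k : ℤ) (m : ℕ) :
    HasSignedCorrelation (binary l r) ((2 : ℤ) ^ (m + 1) • ![1, k, k + 1]) 0 := by
  convert hasSignedCorrelation_two_mul h (2 ^ m) (2 ^ m * k) using 1
  ext j
  fin_cases j <;> simp <;> ring

end RudinShapiro

theorem mainTheorem8 (l r : Fin 4) (hseed : RudinShapiro.IsLegalSeed l r) :
    (∀ (ℓ : ℤ) (n m : ℕ), 1 ≤ n →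
      RudinShapiro.HasSignedCorrelation (RudinShapiro.binary l r)
        ((2 : ℤ) ^ m • ![1, 2 ^ n * (2 * ℓ + 1), 2 ^ n * (2 * ℓ + 1) + 1])
        ((3 / (2 : ℝ) ^ n - 2 * (if n = 1 then 1 else 0)) * (if m = 0 then 1 else 0))) ∧
    (∀ (ℓ : ℤ) (m : ℕ),
      RudinShapiro.HasSignedCorrelation (RudinShapiro.binary l r)
        ((2 : ℤ) ^ m • ![1, 2 * ℓ + 1, 2 * ℓ + 2])
        0) := by
  have hu := RudinShapiro.isFolding_binary hseed
  constructor
  · rintro ℓ n (_ | m) hn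
    · rw [pow_zero, one_smul, if_pos rfl, mul_one, RudinShapiro.hasSignedCorrelation_one_iff]
      exact hu.hasMean_signed_mul_shift ℓ hn
    · rw [if_neg (Nat.succ_ne_zero m), mul_zero]
      exact RudinShapiro.hasSignedCorrelation_pow_smul hseed _ m
  · intro ℓ m
    rw [show 2 * ℓ + 2 = 2 * ℓ + 1 + 1 by ring]
    obtain _ | m := m
    · rw [pow_zero, one_smul, RudinShapiro.hasSignedCorrelation_one_iff]
      exact hu.hasMean_signed_mul_shift_odd ℓ
    · exact RudinShapiro.hasSignedCorrelation_pow_smul hseed _ m
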